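/- Let $\Omega\subset\mathbb R^n$, $n\le 3$, be a bounded open set with Lipschitz boundary, and let $$a(u,v)=\sum_{i,j=1}^n\int_\Omega a_{ij}\,\partial_i u\,\partial_j v\,dx+\sum_{i=1}^n\int_\Omega a_i\,\partial_i u\,v\,dx+\int_\Omega a_0\,u\,v\,dx ,$$ where $a_{ij},a_i,a_0\in L^\infty(\Omega)$, the $a_{ij}$ are Lipschitz continuous on $\overline\Omega$, $a_0\ge 0$ a.e. in $\Omega$, and for some $m_0>0$, for a.e. $x\in\Omega$, $\sum_{i,j}a_{ij}(x)\theta_i\theta_j\ge m_0\sum_{i=1}^n\theta_i^2$ for all $\theta\in\mathbb R^n$. Assume that $a$ is coercive on $H^1_0(\Omega)$: there is $m>0$ with $a(u,u)\ge m\|u\|_{H^1(\Omega)}^2$ for all $u\in H^1_0(\Omega)$. Let $f\in L^2(\Omega)$ and $\mathcal U=H^2(\Omega)\cap H^1_0(\Omega)$. For $\varphi\in\mathcal U$ put $\mathcal K(\varphi)=\{y\in H^1_0(\Omega): y\ge\varphi\text{ a.e. in }\Omega\}$. Then for every $\varphi\in\mathcal U$ there is exactly one $y=:\mathcal T(\varphi)\in\mathcal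 K(\varphi)$ such that $$a(y,v-y)\ \ge\ \int_\Omega f\,(v-y)\,dx\qquad\text{for all } v\in\mathcal K(\varphi),$$ and the control-to-state map $\mathcal T:\mathcal U\to H^1_0(\Omega)$ is sequentially continuous for the weak topologies: if $\varphi_k,\varphi\in\mathcal U$ and $\varphi_k\rightharpoonup\varphi$ weakly in $H^2(\Omega)$, then $\mathcal T(\varphi_k)\rightharpoonup\mathcal T(\varphi)$ weakly in $H^1_0(\Omega)$. -/

import Mathlib

open MeasureTheory Filter Topology
open scoped ContDiff ENNReal

noncomputable section

namespace Obstacle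

/-- `ℝⁿ` with the Euclidean norm. -/
abbrev E (n : ℕ) := EuclideanSpace ℝ (Fin n)

variable {n : ℕ}

/-- The boundary of `Ω` is Lipschitz: near each boundary point, in suitable orthonormal coordinates
with last axis `ν`, the set `Ω` is the part lying strictly above the graph of a Lipschitz function
of the other coordinates (the orthogonal projection `y - ⟪ν, y⟫ ν`). -/
def HasLipschitzBoundary (Ω : Set (E n)) : Prop :=
  ∀ x ∈ frontier Ω, ∃ ν : E n, ‖ν‖ = 1 ∧ ∃ (K : NNReal) (g : E n → ℝ), LipschitzWith K g ∧
    ∃ U ∈ 𝓝 x, ∀ y ∈ U, y ∈ Ω ↔ g (y - inner ℝ ν y • ν) < inner ℝ ν y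

/-- `L²(Ω)`, real-valued, for the Lebesgue measure. -/
abbrev L2 (Ω : Set (E n)) := Lp ℝ 2 (volume.restrict Ω)

/-- The classical partial derivative `∂φ/∂xᵢ`. -/
def pderiv (i : Fin n) (φ : E n → ℝ) (x : E n) : ℝ :=
  fderiv ℝ φ x (EuclideanSpace.single i 1)

/-- `φ ∈ 𝒟(Ω)`: a `C^∞` function with compact support contained in `Ω`. -/
structure IsTest (Ω : Set (E n)) (φ : E n → ℝ) : Prop where
  smooth : ContDiff ℝ ∞ φ
  compact : HasCompactSupport φ
  subset : tsupport φ ⊆ Ω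

/-- `g = ∂u/∂xᵢ` in the weak (distributional) sense on `Ω`. -/
def HasWeakDeriv (Ω : Set (E n)) (i : Fin n) (u g : L2 Ω) : Prop :=
  ∀ φ : E n → ℝ, IsTest Ω φ →
    ∫ x in Ω, u x * pderiv i φ x = -∫ x in Ω, g x * φ x

theorem IsTest.memLp {Ω : Set (E n)} {φ : E n → ℝ} (h : IsTest Ω φ) :
    MemLp φ 2 (volume.restrict Ω) :=
  (h.smooth.continuous.memLp_of_hasCompactSupport h.compact).restrict Ω

theorem IsTest.continuous_pderiv {Ω : Set (E n)} {φ : E n → ℝ} (h : IsTest Ω φ) (i : Fin n) :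
    Continuous (pderiv i φ) :=
  (h.smooth.continuous_fderiv (by simp)).clm_apply continuous_const

theorem IsTest.memLp_pderiv {Ω : Set (E n)} {φ : E n → ℝ} (h : IsTest Ω φ) (i : Fin n) :
    MemLp (pderiv i φ) 2 (volume.restrict Ω) :=
  ((h.continuous_pderiv i).memLp_of_hasCompactSupport
    (h.compact.fderiv_apply ℝ _)).restrict Ω

theorem L2.integrable_mul {Ω : Set (E n)} (u : L2 Ω) {φ : E n → ℝ}
    (h : MemLp φ 2 (volume.restrict Ω)) :
    Integrable (fun x => u x * φ x) (volume.restrict Ω) :=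
  (Lp.memLp u).integrable_mul h

theorem L2.integral_add_mul {Ω : Set (E n)} (u v : L2 Ω) {φ : E n → ℝ}
    (h : MemLp φ 2 (volume.restrict Ω)) :
    ∫ x in Ω, (u + v) x * φ x = (∫ x in Ω, u x * φ x) + ∫ x in Ω, v x * φ x := by
  rw [← integral_add (L2.integrable_mul u h) (L2.integrable_mul v h)]
  refine integral_congr_ae ?_
  filter_upwards [Lp.coeFn_add u v] with x hx
  rw [hx, Pi.add_apply, add_mul]

theorem L2.integral_smul_mul {Ω : Set (E n)} (c : ℝ) (u : L2 Ω) (φ : E n → ℝ) :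
    ∫ x in Ω, (c • u) x * φ x = c * ∫ x in Ω, u x * φ x := by
  rw [← integral_const_mul]
  refine integral_congr_ae ?_
  filter_upwards [Lp.coeFn_smul c u] with x hx
  rw [hx, Pi.smul_apply, smul_eq_mul, mul_assoc]

theorem L2.integral_zero_mul {Ω : Set (E n)} (φ : E n → ℝ) :
    ∫ x in Ω, (0 : L2 Ω) x * φ x = 0 := by
  have h := L2.integral_smul_mul (0 : ℝ) (0 : L2 Ω) φ
  rwa [zero_smul, zero_mul] at h

theorem HasWeakDeriv.zero (Ω : Set (E n)) (i : Fin n) : HasWeakDeriv Ω i 0 0 := by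
  intro φ _
  rw [L2.integral_zero_mul, L2.integral_zero_mul, neg_zero]

theorem HasWeakDeriv.add {Ω : Set (E n)} {i : Fin n} {u v g h : L2 Ω}
    (hu : HasWeakDeriv Ω i u g) (hv : HasWeakDeriv Ω i v h) :
    HasWeakDeriv Ω i (u + v) (g + h) := by
  intro φ hφ
  rw [L2.integral_add_mul _ _ (hφ.memLp_pderiv i), L2.integral_add_mul _ _ hφ.memLp,
    hu φ hφ, hv φ hφ, neg_add]

theorem HasWeakDeriv.smul {Ω : Set (E n)} {i : Fin n} {u g : L2 Ω} (c : ℝ)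
    (hu : HasWeakDeriv Ω i u g) : HasWeakDeriv Ω i (c • u) (c • g) := by
  intro φ hφ
  rw [L2.integral_smul_mul, L2.integral_smul_mul, hu φ hφ, mul_neg]

/-- Pairs `(u, (gᵢ)ᵢ)` in `L²(Ω) × L²(Ω)ⁿ`, with the Hilbert norm. -/
abbrev Jet1 (Ω : Set (E n)) := WithLp 2 (L2 Ω × PiLp 2 (fun _ : Fin n => L2 Ω))

/-- Pairs `((u, (gᵢ)ᵢ), (hᵢⱼ)ᵢⱼ)`, with the Hilbert norm. -/
abbrev Jet2 (Ω : Set (E n)) := WithLp 2 (Jet1 Ω × PiLp 2 (fun _ : Fin n × Fin n => L2 Ω))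

/-- The Sobolev space `H¹(Ω)`: each `u ∈ L²(Ω)` that has weak first derivatives in `L²(Ω)`,
stored together with these (unique) derivatives, with
`‖u‖² = ‖u‖²_{L²} + ∑ᵢ ‖∂ᵢu‖²_{L²}`. -/
def H1 (Ω : Set (E n)) : Submodule ℝ (Jet1 Ω) where
  carrier := {w | ∀ i, HasWeakDeriv Ω i w.fst (w.snd i)}
  zero_mem' := fun i => HasWeakDeriv.zero Ω i
  add_mem' := fun hu hv i => (hu i).add (hv i)
  smul_mem' := fun c _ hu i => (hu i).smul c

/-- The Sobolev space `H²(Ω)`: each `u ∈ H¹(Ω)` whose first derivatives have weak derivatives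
in `L²(Ω)`, with `‖u‖² = ‖u‖²_{H¹} + ∑ᵢⱼ ‖∂ⱼ∂ᵢu‖²_{L²}`. -/
def H2 (Ω : Set (E n)) : Submodule ℝ (Jet2 Ω) where
  carrier := {w | w.fst ∈ H1 Ω ∧ ∀ i j, HasWeakDeriv Ω j (w.fst.snd i) (w.snd (i, j))}
  zero_mem' := ⟨(H1 Ω).zero_mem, fun _ j => HasWeakDeriv.zero Ω j⟩
  add_mem' := fun hu hv => ⟨(H1 Ω).add_mem hu.1 hv.1, fun i j => (hu.2 i j).add (hv.2 i j)⟩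
  smul_mem' := fun c _ hu => ⟨(H1 Ω).smul_mem c hu.1, fun i j => (hu.2 i j).smul c⟩

/-- The underlying `L²` function of an element of `H¹(Ω)`. -/
def H1.fn {Ω : Set (E n)} (u : H1 Ω) : L2 Ω := (u : Jet1 Ω).fst

/-- The weak partial derivative `∂u/∂xᵢ` of an element of `H¹(Ω)`. -/
def H1.deriv {Ω : Set (E n)} (u : H1 Ω) (i : Fin n) : L2 Ω := (u : Jet1 Ω).snd i

/-- The inclusion `H²(Ω) ⊆ H¹(Ω)`. -/
def H2.toH1 (Ω : Set (E n)) : H2 Ω →ₗ[ℝ] H1 Ω where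
  toFun w := ⟨(w : Jet2 Ω).fst, w.2.1⟩
  map_add' _ _ := rfl
  map_smul' _ _ := rfl

/-- `𝒟(Ω)` as a subspace of `H¹(Ω)`. -/
def testSubspace (Ω : Set (E n)) : Submodule ℝ (H1 Ω) where
  carrier := {u | ∃ φ : E n → ℝ, IsTest Ω φ ∧ H1.fn u =ᵐ[volume.restrict Ω] φ}
  zero_mem' := by
    refine ⟨0, ⟨contDiff_const, HasCompactSupport.zero, by simp [tsupport]⟩, ?_⟩
    exact Lp.coeFn_zero _ _ _
  add_mem' := by
    rintro u v ⟨φ, hφ, hu⟩ ⟨ψ, hψ, hv⟩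
    refine ⟨φ + ψ, ⟨hφ.smooth.add hψ.smooth, hφ.compact.add hψ.compact, ?_⟩, ?_⟩
    · exact (tsupport_add φ ψ).trans (Set.union_subset hφ.subset hψ.subset)
    · exact (Lp.coeFn_add (H1.fn u) (H1.fn v)).trans (hu.add hv)
  smul_mem' := by
    rintro c u ⟨φ, hφ, hu⟩
    refine ⟨c • φ, ⟨contDiff_const.smul hφ.smooth, hφ.compact.smul_left (f := fun _ => c), ?_⟩, ?_⟩
    · exact (tsupport_smul_subset_right (fun _ => c) φ).trans hφ.subset
    · exact (Lp.coeFn_smul c (H1.fn u)).trans (hu.const_smul c)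

/-- `H¹₀(Ω)`: the closure of `𝒟(Ω)` in `H¹(Ω)`. -/
def H10 (Ω : Set (E n)) : Submodule ℝ (H1 Ω) := (testSubspace Ω).topologicalClosure

/-- The control space `𝒰 = H²(Ω) ∩ H¹₀(Ω)`, as a subspace of `H²(Ω)`. -/
def ControlSpace (Ω : Set (E n)) : Submodule ℝ (H2 Ω) := (H10 Ω).comap (H2.toH1 Ω)

/-- Coefficients `aᵢⱼ`, `aᵢ`, `a₀` of a second order operator in divergence form. -/
structure Coeffs (n : ℕ) where
  a₂ : Fin n → Fin n → E n → ℝ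
  a₁ : Fin n → E n → ℝ
  a₀ : E n → ℝ

/-- The assumptions on the coefficients: all are in `L^∞(Ω)`, the `aᵢⱼ` are Lipschitz on the closure
of `Ω` and uniformly elliptic, and `a₀` is nonnegative. -/
structure Coeffs.IsAdmissible (c : Coeffs n) (Ω : Set (E n)) : Prop where
  bdd₂ : ∀ i j, MemLp (c.a₂ i j) ∞ (volume.restrict Ω)
  bdd₁ : ∀ i, MemLp (c.a₁ i) ∞ (volume.restrict Ω)
  bdd₀ : MemLp c.a₀ ∞ (volume.restrict Ω)
  lipschitz : ∀ i j, ∃ K : NNReal, LipschitzOnWith K (c.a₂ i j) (closure Ω)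
  elliptic : ∃ m : ℝ, 0 < m ∧ ∀ᵐ x ∂(volume.restrict Ω), ∀ θ : Fin n → ℝ,
    m * ∑ i, θ i ^ 2 ≤ ∑ i, ∑ j, c.a₂ i j x * θ i * θ j
  nonneg : ∀ᵐ x ∂(volume.restrict Ω), 0 ≤ c.a₀ x

/-- The bilinear form
`a(u,v) = ∑ᵢⱼ ∫ aᵢⱼ ∂ᵢu ∂ⱼv + ∑ᵢ ∫ aᵢ ∂ᵢu v + ∫ a₀ u v`. -/
def Coeffs.form (c : Coeffs n) {Ω : Set (E n)} (u v : H1 Ω) : ℝ :=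
  (∑ i, ∑ j, ∫ x in Ω, c.a₂ i j x * H1.deriv u i x * H1.deriv v j x)
    + (∑ i, ∫ x in Ω, c.a₁ i x * H1.deriv u i x * H1.fn v x)
    + ∫ x in Ω, c.a₀ x * H1.fn u x * H1.fn v x

/-- `a` is coercive on `H¹₀(Ω)`. -/
def Coeffs.IsCoercive (c : Coeffs n) (Ω : Set (E n)) : Prop :=
  ∃ m : ℝ, 0 < m ∧ ∀ u : H10 Ω, m * ‖u‖ ^ 2 ≤ c.form (u : H1 Ω) (u : H1 Ω)

/-- `𝒦(φ) = {y ∈ H¹₀(Ω) : y ≥ φ a.e. in Ω}`. -/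
def constraintSet {Ω : Set (E n)} (φ : H1 Ω) : Set (H10 Ω) :=
  {y | ∀ᵐ x ∂(volume.restrict Ω), H1.fn φ x ≤ H1.fn (y : H1 Ω) x}

/-- `y` solves the obstacle problem with obstacle `φ` and source `f`: `y ∈ 𝒦(φ)` and
`a(y, v - y) ≥ (f, v - y)` for all `v ∈ 𝒦(φ)`. -/
def IsSolution (c : Coeffs n) {Ω : Set (E n)} (f : L2 Ω) (φ : H1 Ω) (y : H10 Ω) : Prop :=
  y ∈ constraintSet φ ∧ ∀ v ∈ constraintSet φ,
    ∫ x in Ω, f x * H1.fn ((v - y : H10 Ω) : H1 Ω) x ≤ c.form (y : H1 Ω) ((v - y : H10 Ω) : H1 Ω)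

/-- The control-to-state map `𝒯`: the solution of the obstacle problem with obstacle `φ ∈ 𝒰`
(an arbitrary element if there were none). -/
def controlToState (c : Coeffs n) {Ω : Set (E n)} (f : L2 Ω) (φ : ControlSpace Ω) : H10 Ω :=
  Classical.epsilon (IsSolution c f (H2.toH1 Ω (φ : H2 Ω)))

/-- Weak convergence of a sequence in a normed space: `ℓ(x_k) → ℓ(l)` for every continuous linear
functional `ℓ`. -/
def WeaklyConverges {X : Type*} [NormedAddCommGroup X] [NormedSpace ℝ X] (x : ℕ → X) (l : X) :
    Prop :=
  ∀ ℓ : X →L[ℝ] ℝ, Tendsto (fun k => ℓ (x k)) atTop (𝓝 (ℓ l))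

end Obstacle

end

namespace Obstacle

/-! Existence is the Lions–Stampacchia theorem (`exists_variational_inequality`). Since obstacles in
`𝒰` lie in `H¹₀(Ω)`, constraint sets are translates of one another: `𝒦(φ') = 𝒦(φ) + (φ' - φ)`.
Testing each of two variational inequalities with the translated solution of the other, coercivity
gives `‖y - y'‖ ≤ C ‖φ - φ'‖` in `H¹₀(Ω)` (`exists_norm_sub_le`). Equal obstacles yield uniqueness.

It remains to see that weak `H²` convergence in `𝒰` forces strong `H¹` convergence
(`tendsto_norm_toH10_sub`). For `w = φ_k - φ`, Green's formula gives `‖∇w‖² = -∫ Δw w ≤ ‖Δw‖ ‖w‖`.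
The Laplacians are bounded and `w → 0` in `L²(Ω)` by Rellich's theorem. Hence the states converge
even strongly, and in particular weakly.

Rellich's theorem is proved by Fourier analysis on test functions: high frequencies are small
uniformly because of the gradient bound, low frequencies vanish by dominated convergence. Density
carries it to `H¹₀(Ω)`. -/

theorem eq_of_norm_sub_le_mul_norm_sub_self {V : Type*} [NormedAddCommGroup V] {x y z : V} {C : ℝ}
    (h : ‖x - y‖ ≤ C * ‖z - z‖) : x = y := by
  simpa [sub_eq_zero] using h

/-! ### Variational inequalities in Hilbert space -/

section Abstract

variable {V : Type*} [NormedAddCommGroup V] [InnerProductSpace ℝ V]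

/-- Nonexpansiveness of the projection onto a convex set, with `p`, `p'` the projections of `u`,
`u'`: adding the two obtuse-angle conditions gives `‖p - p'‖² ≤ ⟪u - u', p - p'⟫`, and
Cauchy–Schwarz concludes. -/
theorem norm_sub_le_of_inner_le_zero {u u' p p' : V}
    (h : inner ℝ (u - p) (p' - p) ≤ 0) (h' : inner ℝ (u' - p') (p - p') ≤ 0) :
    ‖p - p'‖ ≤ ‖u - u'‖ := by
  have h1 : ‖p - p'‖ ^ 2 ≤ inner ℝ (u - u') (p - p') := by
    rw [← real_inner_self_eq_norm_sq]
    have e1 : inner ℝ (u - p) (p' - p) = -inner ℝ (u - p) (p - p') := by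
      rw [← inner_neg_right, neg_sub]
    have e2 : inner ℝ (u - u') (p - p') - inner ℝ (p - p') (p - p')
        = inner ℝ (u - p) (p - p') - inner ℝ (u' - p') (p - p') := by
      rw [← inner_sub_left, ← inner_sub_left]
      congr 1
      abel
    linarith
  have h2 := real_inner_le_norm (u - u') (p - p')
  by_contra! hlt
  nlinarith [norm_nonneg (u - u'), norm_nonneg (p - p')]

/-- The Lions–Stampacchia theorem. -/
theorem exists_variational_inequality [CompleteSpace V] {B : V →L[ℝ] V →L[ℝ] ℝ}
    (hB : IsCoercive B) (ℓ : V →L[ℝ] ℝ) {K : Set V} (hne : K.Nonempty) (hcl : IsClosed K)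
    (hconv : Convex ℝ K) : ∃ y ∈ K, ∀ v ∈ K, ℓ (v - y) ≤ B y (v - y) := by
  obtain ⟨m, hm, hmB⟩ := hB
  set A := InnerProductSpace.continuousLinearMapOfBilin (𝕜 := ℝ) B with hA
  have hAB : ∀ v w, inner ℝ (A v) w = B v w :=
    InnerProductSpace.continuousLinearMapOfBilin_apply B
  set b := (InnerProductSpace.toDual ℝ V).symm ℓ with hb
  have hbl : ∀ w, inner ℝ b w = ℓ w := fun w => InnerProductSpace.toDual_symm_apply
  have hP : ∀ u : V, ∃ p ∈ K, ∀ w ∈ K, inner ℝ (u - p) (w - p) ≤ 0 := fun u => by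
    obtain ⟨p, hp, h⟩ := exists_norm_eq_iInf_of_complete_convex hne hcl.isComplete hconv u
    exact ⟨p, hp, (norm_eq_iInf_iff_real_inner_le_zero hconv hp).1 h⟩
  choose P hPK hPin using hP
  set M := ‖A‖ with hM
  have hM0 : 0 ≤ M := norm_nonneg _
  -- The step `d ↦ d - ρ A d` scales squared norms by at most `1 - 2ρm + ρ²M²`. This `ρ` makes `ρ²M²
  -- ≤ ρm`, leaving `1 - ρm`. The `m ^ 2` in the denominator covers `M = 0` and ensures `ρm ≤ 1`.
  set ρ := m / (M ^ 2 + m ^ 2) with hρ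
  have hD : 0 < M ^ 2 + m ^ 2 := by positivity
  have hρ0 : 0 < ρ := by positivity
  have hρD : ρ * (M ^ 2 + m ^ 2) = m := by rw [hρ]; field_simp
  let q : NNReal := ⟨Real.sqrt (1 - ρ * m), Real.sqrt_nonneg _⟩
  have hρm : 0 ≤ 1 - ρ * m := by
    have : ρ * m = m ^ 2 / (M ^ 2 + m ^ 2) := by rw [hρ]; ring
    rw [this, sub_nonneg, div_le_one hD]
    nlinarith
  have hq1 : q < 1 := by
    rw [← NNReal.coe_lt_coe]
    change Real.sqrt (1 - ρ * m) < 1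
    rw [Real.sqrt_lt' one_pos]
    nlinarith [mul_pos hρ0 hm]
  -- At a fixed point, the obtuse-angle condition reads `-ρ ⟪A y - b, v - y⟫ ≤ 0`, which is the
  -- variational inequality.
  let S : K → K := fun y => ⟨P (y - ρ • (A y - b)), hPK _⟩
  have hS : LipschitzWith q S := by
    refine LipschitzWith.of_dist_le_mul fun y z => ?_
    rw [Subtype.dist_eq, Subtype.dist_eq, dist_eq_norm, dist_eq_norm]
    have h1 : ‖(S y : V) - S z‖ ≤ ‖(y - ρ • (A y - b) : V) - (z - ρ • (A z - b))‖ :=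
      norm_sub_le_of_inner_le_zero (hPin _ _ (hPK _)) (hPin _ _ (hPK _))
    have h2 : (y - ρ • (A y - b) : V) - (z - ρ • (A z - b))
        = ((y : V) - z) - ρ • A ((y : V) - z) := by
      rw [map_sub]; module
    rw [h2] at h1
    refine h1.trans ?_
    set d : V := (y : V) - z
    refine le_of_sq_le_sq ?_ (mul_nonneg q.2 (norm_nonneg _))
    have h3 : (q : ℝ) ^ 2 = 1 - ρ * m := Real.sq_sqrt hρm
    rw [mul_pow, h3, norm_sub_sq_real, inner_smul_right, real_inner_comm, hAB, norm_smul,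
      Real.norm_eq_abs, abs_of_pos hρ0, mul_pow]
    have h4 : ‖A d‖ ^ 2 ≤ M ^ 2 * ‖d‖ ^ 2 := by
      rw [← mul_pow]
      exact pow_le_pow_left₀ (norm_nonneg _) (A.le_opNorm d) 2
    have h5 := hmB d
    have h6 : ρ ^ 2 * ‖A d‖ ^ 2 ≤ ρ * m * ‖d‖ ^ 2 := by
      calc ρ ^ 2 * ‖A d‖ ^ 2 ≤ ρ ^ 2 * (M ^ 2 * ‖d‖ ^ 2) := by gcongr
        _ ≤ ρ ^ 2 * ((M ^ 2 + m ^ 2) * ‖d‖ ^ 2) := by gcongr; nlinarith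
        _ = ρ * (ρ * (M ^ 2 + m ^ 2)) * ‖d‖ ^ 2 := by ring
        _ = _ := by rw [hρD]
    have h7 : ρ * (m * ‖d‖ * ‖d‖) ≤ ρ * B d d := by gcongr
    nlinarith
  have : Nonempty K := hne.to_subtype
  have : CompleteSpace K := hcl.completeSpace_coe
  have hfix := ContractingWith.fixedPoint_isFixedPt (f := S) ⟨hq1, hS⟩
  set y := ContractingWith.fixedPoint S ⟨hq1, hS⟩
  refine ⟨y, y.2, fun v hv => ?_⟩
  have h1 := hPin ((y : V) - ρ • (A y - b)) v hv
  have h2 : P ((y : V) - ρ • (A y - b)) = y := congrArg Subtype.val hfix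
  rw [h2, show (y : V) - ρ • (A y - b) - y = -(ρ • (A y - b)) by abel, inner_neg_left,
    inner_smul_left, inner_sub_left, hAB, hbl] at h1
  have h3 : 0 ≤ ρ * (B y (v - y) - ℓ (v - y)) := by simpa using h1
  linarith [nonneg_of_mul_nonneg_right h3 hρ0]

/-- Solutions of coercive variational inequalities over two translates of each other differ by at
most a constant times the translation. -/
theorem norm_sub_le_of_variational_inequality {B : V →L[ℝ] V →L[ℝ] ℝ} {m : ℝ} (hm : 0 < m)
    (hB : ∀ u, m * ‖u‖ ^ 2 ≤ B u u) {ℓ : V →L[ℝ] ℝ} {y y' d : V}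
    (h : ℓ (y' + d - y) ≤ B y (y' + d - y)) (h' : ℓ (y - d - y') ≤ B y' (y - d - y')) :
    ‖y - y'‖ ≤ ‖B‖ / m * ‖d‖ := by
  have h3 := hB (y - y')
  -- The test vectors in `h` and `h'` are opposite, so `ℓ` cancels on adding.
  have h4 : B (y - y') (y - y') ≤ B (y - y') d := by
    simp only [map_add, map_sub, sub_apply] at h h' ⊢
    linarith
  have h5 : B (y - y') d ≤ ‖B‖ * ‖y - y'‖ * ‖d‖ :=
    (le_abs_self _).trans (B.le_opNorm₂ _ _)
  rw [div_mul_eq_mul_div, le_div_iff₀ hm]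
  rcases (norm_nonneg (y - y')).eq_or_lt with h0 | h0
  · rw [← h0, zero_mul]
    positivity
  · refine le_of_mul_le_mul_right ?_ h0
    nlinarith

end Abstract

/-! ### Weakly convergent sequences -/

/-- Uniform boundedness on the dual, applied to the images of `x k` in the bidual, followed by the
isometry of the canonical embedding. -/
theorem WeaklyConverges.exists_norm_le {X : Type*} [NormedAddCommGroup X] [NormedSpace ℝ X]
    {x : ℕ → X} {l : X} (h : WeaklyConverges x l) : ∃ C, ∀ k, ‖x k‖ ≤ C := by
  obtain ⟨C, hC⟩ := banach_steinhaus
    (g := fun k => NormedSpace.inclusionInDoubleDual ℝ X (x k)) fun ℓ => by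
      obtain ⟨C, hC⟩ := (h ℓ).norm.bddAbove_range
      exact ⟨C, fun k => hC ⟨k, rfl⟩⟩
  refine ⟨C, fun k => ?_⟩
  rw [← (NormedSpace.inclusionInDoubleDualLi ℝ (E := X)).norm_map (x k)]
  exact hC k

theorem WeaklyConverges.of_tendsto {X : Type*} [NormedAddCommGroup X] [NormedSpace ℝ X]
    {x : ℕ → X} {l : X} (h : Tendsto x atTop (𝓝 l)) : WeaklyConverges x l :=
  fun ℓ => (ℓ.continuous.tendsto l).comp h

theorem WeaklyConverges.map {X Y : Type*} [NormedAddCommGroup X] [NormedSpace ℝ X]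
    [NormedAddCommGroup Y] [NormedSpace ℝ Y] {x : ℕ → X} {l : X} (h : WeaklyConverges x l)
    (T : X →L[ℝ] Y) : WeaklyConverges (fun k => T (x k)) (T l) :=
  fun ℓ => h (ℓ.comp T)

theorem WeaklyConverges.sub_limit {X : Type*} [NormedAddCommGroup X] [NormedSpace ℝ X]
    {x : ℕ → X} {l : X} (h : WeaklyConverges x l) : WeaklyConverges (fun k => x k - l) 0 :=
  fun ℓ => by simpa using (h ℓ).sub_const (ℓ l)

end Obstacle

noncomputable section

namespace Obstacle

variable {n : ℕ} {Ω : Set (E n)}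

local instance : NormedAddCommGroup (H1 Ω) := inferInstance
local instance : InnerProductSpace ℝ (H1 Ω) := inferInstance
local instance : NormedSpace ℝ (H1 Ω) := inferInstance
local instance : NormedAddCommGroup (H10 Ω) := inferInstance
local instance : InnerProductSpace ℝ (H10 Ω) := inferInstance
local instance : NormedSpace ℝ (H10 Ω) := inferInstance
local instance : NormedAddCommGroup (H2 Ω) := inferInstance
local instance : NormedSpace ℝ (H2 Ω) := inferInstance

/-! ### Completeness of the Sobolev spaces and boundedness of the form -/

theorem L2.inner_toLp (u : L2 Ω) {φ : E n → ℝ} (h : MemLp φ 2 (volume.restrict Ω)) :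
    inner ℝ (h.toLp φ) u = ∫ x in Ω, u x * φ x := by
  rw [MeasureTheory.L2.inner_def]
  refine integral_congr_ae ?_
  filter_upwards [h.coeFn_toLp] with x hx
  simp [hx]

theorem L2.continuous_integral_mul {φ : E n → ℝ} (h : MemLp φ 2 (volume.restrict Ω)) :
    Continuous fun u : L2 Ω => ∫ x in Ω, u x * φ x := by
  simp_rw [← L2.inner_toLp _ h]
  fun_prop

/-- `u ↦ u` as a continuous linear map `H¹(Ω) → L²(Ω)`. -/
def H1.fnL (Ω : Set (E n)) : H1 Ω →L[ℝ] L2 Ω :=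
  (WithLp.fstL 2 ℝ (L2 Ω) (PiLp 2 fun _ : Fin n => L2 Ω)) ∘L (H1 Ω).subtypeL

/-- `u ↦ ∂u/∂xᵢ` as a continuous linear map `H¹(Ω) → L²(Ω)`. -/
def H1.derivL (Ω : Set (E n)) (i : Fin n) : H1 Ω →L[ℝ] L2 Ω :=
  (PiLp.proj 2 (fun _ : Fin n => L2 Ω) i) ∘L
    (WithLp.sndL 2 ℝ (L2 Ω) (PiLp 2 fun _ : Fin n => L2 Ω)) ∘L (H1 Ω).subtypeL

@[simp] theorem H1.fnL_apply (u : H1 Ω) : H1.fnL Ω u = H1.fn u := rfl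

@[simp] theorem H1.derivL_apply (u : H1 Ω) (i : Fin n) : H1.derivL Ω i u = H1.deriv u i := rfl

theorem H1.norm_sq_eq (u : H1 Ω) :
    ‖u‖ ^ 2 = ‖H1.fn u‖ ^ 2 + ∑ i, ‖H1.deriv u i‖ ^ 2 := by
  rw [← Submodule.norm_coe, WithLp.prod_norm_sq_eq_of_L2, PiLp.norm_sq_eq_of_L2]
  rfl

theorem H1.norm_fn_le (u : H1 Ω) : ‖H1.fn u‖ ≤ ‖u‖ := by
  refine le_of_sq_le_sq ?_ (norm_nonneg _)
  rw [H1.norm_sq_eq]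
  have : 0 ≤ ∑ i, ‖H1.deriv u i‖ ^ 2 := Finset.sum_nonneg fun i _ => sq_nonneg _
  linarith

theorem H1.norm_deriv_le (u : H1 Ω) (i : Fin n) : ‖H1.deriv u i‖ ≤ ‖u‖ := by
  refine le_of_sq_le_sq ?_ (norm_nonneg _)
  rw [H1.norm_sq_eq]
  have := Finset.single_le_sum (f := fun i => ‖H1.deriv u i‖ ^ 2) (fun i _ => sq_nonneg _)
    (Finset.mem_univ i)
  have := sq_nonneg ‖H1.fn u‖
  linarith

/-- Each test function imposes one closed condition, since pairing with a fixed `L²` function is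
continuous. -/
theorem H1.isClosed (Ω : Set (E n)) : IsClosed (H1 Ω : Set (Jet1 Ω)) := by
  have : (H1 Ω : Set (Jet1 Ω)) = ⋂ i, ⋂ φ : E n → ℝ, ⋂ _ : IsTest Ω φ,
      {w | ∫ x in Ω, w.fst x * pderiv i φ x = -∫ x in Ω, w.snd i x * φ x} := by
    ext w
    simp [H1, HasWeakDeriv]
  rw [this]
  refine isClosed_iInter fun i => isClosed_iInter fun φ => isClosed_iInter fun hφ =>
    isClosed_eq ?_ ?_
  · exact (L2.continuous_integral_mul (hφ.memLp_pderiv i)).comp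
      (WithLp.fstL 2 ℝ (L2 Ω) (PiLp 2 fun _ : Fin n => L2 Ω)).continuous
  · exact ((L2.continuous_integral_mul hφ.memLp).comp
      ((PiLp.proj 2 (𝕜 := ℝ) (fun _ : Fin n => L2 Ω) i) ∘L
        (WithLp.sndL 2 ℝ (L2 Ω) (PiLp 2 fun _ : Fin n => L2 Ω))).continuous).neg

instance : CompleteSpace (H1 Ω) := (H1.isClosed Ω).completeSpace_coe

instance : CompleteSpace (H10 Ω) :=
  (Submodule.isClosed_topologicalClosure _).completeSpace_coe

/-- The bounded bilinear form `(u, v) ↦ ∫ a u v` on `L²(Ω)`, for `a ∈ L^∞(Ω)`. -/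
def weightedInner {a : E n → ℝ} (ha : MemLp a ∞ (volume.restrict Ω)) :
    L2 Ω →L[ℝ] L2 Ω →L[ℝ] ℝ :=
  (innerSL ℝ) ∘L ((ContinuousLinearMap.mul ℝ ℝ).holderL (volume.restrict Ω) ∞ 2 2 (ha.toLp a))

theorem weightedInner_apply {a : E n → ℝ} (ha : MemLp a ∞ (volume.restrict Ω)) (u v : L2 Ω) :
    weightedInner ha u v = ∫ x in Ω, a x * u x * v x := by
  change inner ℝ ((ContinuousLinearMap.mul ℝ ℝ).holder 2 (ha.toLp a) u) v = _
  rw [MeasureTheory.L2.inner_def]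
  refine integral_congr_ae ?_
  filter_upwards [(ContinuousLinearMap.mul ℝ ℝ).coeFn_holder (r := 2) (ha.toLp a) u,
    ha.coeFn_toLp] with x hx hx'
  rw [hx, hx']
  simp [mul_comm]

/-- The bilinear form `a` as a bounded bilinear form on `H¹(Ω)`. -/
def Coeffs.IsAdmissible.formL {c : Coeffs n} (hc : c.IsAdmissible Ω) :
    H1 Ω →L[ℝ] H1 Ω →L[ℝ] ℝ :=
  (∑ i, ∑ j, (weightedInner (hc.bdd₂ i j)).bilinearComp (H1.derivL Ω i) (H1.derivL Ω j))
    + (∑ i, (weightedInner (hc.bdd₁ i)).bilinearComp (H1.derivL Ω i) (H1.fnL Ω))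
    + (weightedInner hc.bdd₀).bilinearComp (H1.fnL Ω) (H1.fnL Ω)

theorem Coeffs.IsAdmissible.formL_apply {c : Coeffs n} (hc : c.IsAdmissible Ω) (u v : H1 Ω) :
    hc.formL u v = c.form u v := by
  simp [formL, Coeffs.form, weightedInner_apply]

/-- The bilinear form `a` as a bounded bilinear form on `H¹₀(Ω)`. -/
def Coeffs.IsAdmissible.form₀ {c : Coeffs n} (hc : c.IsAdmissible Ω) :
    H10 Ω →L[ℝ] H10 Ω →L[ℝ] ℝ :=
  hc.formL.bilinearComp (H10 Ω).subtypeL (H10 Ω).subtypeL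

theorem Coeffs.IsAdmissible.form₀_apply {c : Coeffs n} (hc : c.IsAdmissible Ω) (u v : H10 Ω) :
    hc.form₀ u v = c.form (u : H1 Ω) (v : H1 Ω) :=
  hc.formL_apply _ _

/-! ### The obstacle problem: existence, stability, uniqueness -/

theorem mem_constraintSet_iff {φ : H1 Ω} {y : H10 Ω} :
    y ∈ constraintSet φ ↔ H1.fn φ ≤ H1.fn (y : H1 Ω) :=
  Lp.coeFn_le _ _

theorem isClosed_constraintSet (φ : H1 Ω) : IsClosed (constraintSet φ) := by
  have : constraintSet φ = (fun y : H10 Ω => H1.fnL Ω y) ⁻¹' Set.Ici (H1.fn φ) := by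
    ext y
    exact mem_constraintSet_iff
  rw [this]
  exact isClosed_Ici.preimage ((H1.fnL Ω).continuous.comp continuous_subtype_val)

theorem convex_constraintSet (φ : H1 Ω) : Convex ℝ (constraintSet φ) := by
  intro y hy z hz s t hs ht hst
  have e : H1.fn ((s • y + t • z : H10 Ω) : H1 Ω)
      = s • H1.fn (y : H1 Ω) + t • H1.fn (z : H1 Ω) := rfl
  change ∀ᵐ x ∂_, _
  rw [e]
  filter_upwards [hy, hz, Lp.coeFn_add (s • H1.fn (y : H1 Ω)) (t • H1.fn (z : H1 Ω)),
    Lp.coeFn_smul s (H1.fn (y : H1 Ω)), Lp.coeFn_smul t (H1.fn (z : H1 Ω))] with x h1 h2 h3 h4 h5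
  rw [h3, Pi.add_apply, h4, h5]
  simp only [Pi.smul_apply, smul_eq_mul]
  rw [← one_mul (H1.fn φ x), ← hst, add_mul]
  gcongr

/-- The functional `v ↦ ∫ f v` on `H¹₀(Ω)`. -/
def sourceL (f : L2 Ω) : H10 Ω →L[ℝ] ℝ := (innerSL ℝ f) ∘L (H1.fnL Ω) ∘L (H10 Ω).subtypeL

theorem sourceL_apply (f : L2 Ω) (v : H10 Ω) :
    sourceL f v = ∫ x in Ω, f x * H1.fn (v : H1 Ω) x := by
  change inner ℝ f (H1.fn (v : H1 Ω)) = _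
  rw [MeasureTheory.L2.inner_def]
  simp [mul_comm]

theorem isSolution_iff {c : Coeffs n} (hc : c.IsAdmissible Ω) {f : L2 Ω} {φ : H1 Ω} {y : H10 Ω} :
    IsSolution c f φ y ↔
      y ∈ constraintSet φ ∧ ∀ v ∈ constraintSet φ, sourceL f (v - y) ≤ hc.form₀ y (v - y) := by
  simp only [IsSolution, sourceL_apply, hc.form₀_apply]

theorem exists_isSolution {c : Coeffs n} (hc : c.IsAdmissible Ω) (hcoer : c.IsCoercive Ω)
    (f : L2 Ω) {φ : H1 Ω} (hφ : φ ∈ H10 Ω) : ∃ y, IsSolution c f φ y := by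
  have hB : IsCoercive hc.form₀ := by
    obtain ⟨m, hm, h⟩ := hcoer
    refine ⟨m, hm, fun u => ?_⟩
    rw [hc.form₀_apply]
    linarith [h u]
  -- The obstacle is itself an admissible state.
  have hne : (constraintSet φ).Nonempty := ⟨⟨φ, hφ⟩, mem_constraintSet_iff.2 le_rfl⟩
  obtain ⟨y, hy, h⟩ := exists_variational_inequality hB (sourceL f) hne
    (isClosed_constraintSet φ) (convex_constraintSet φ)
  exact ⟨y, (isSolution_iff hc).2 ⟨hy, h⟩⟩

/-- Supplies the competitors in the stability estimate; it requires both obstacles to have zero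
trace. -/
theorem add_sub_mem_constraintSet {φ φ' y : H10 Ω} (hy : y ∈ constraintSet (φ : H1 Ω)) :
    y + (φ' - φ) ∈ constraintSet (φ' : H1 Ω) := by
  rw [mem_constraintSet_iff] at hy ⊢
  have e : H1.fn ((y + (φ' - φ) : H10 Ω) : H1 Ω)
      = H1.fn (y : H1 Ω) + (H1.fn (φ' : H1 Ω) - H1.fn (φ : H1 Ω)) := rfl
  rw [e, add_sub_left_comm]
  exact le_add_of_nonneg_right (sub_nonneg.2 hy)

/-- Solutions depend Lipschitz continuously on the obstacle in `H¹₀(Ω)`. -/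
theorem exists_norm_sub_le {c : Coeffs n} (hc : c.IsAdmissible Ω) (hcoer : c.IsCoercive Ω)
    (f : L2 Ω) : ∃ C : ℝ, ∀ φ φ' y y' : H10 Ω, IsSolution c f φ y → IsSolution c f φ' y' →
      ‖y - y'‖ ≤ C * ‖φ - φ'‖ := by
  obtain ⟨m, hm, hcoer⟩ := hcoer
  refine ⟨‖hc.form₀‖ / m, fun φ φ' y y' h h' => ?_⟩
  rw [isSolution_iff hc] at h h'
  refine norm_sub_le_of_variational_inequality hm
    (fun u => (hcoer u).trans_eq (hc.form₀_apply u u).symm) (h.2 _ ?_) (h'.2 _ ?_)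
  · exact add_sub_mem_constraintSet h'.1
  · rw [← neg_sub φ' φ, sub_neg_eq_add]
    exact add_sub_mem_constraintSet h.1

theorem IsSolution.unique {c : Coeffs n} (hc : c.IsAdmissible Ω) (hcoer : c.IsCoercive Ω)
    {f : L2 Ω} {φ y y' : H10 Ω} (h : IsSolution c f φ y) (h' : IsSolution c f φ y') : y = y' := by
  obtain ⟨C, hC⟩ := exists_norm_sub_le hc hcoer f
  exact eq_of_norm_sub_le_mul_norm_sub_self (hC φ φ y y' h h')

/-- The inclusion of the control space into `H¹₀(Ω)`. -/
def ControlSpace.toH10 (φ : ControlSpace Ω) : H10 Ω :=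
  ⟨H2.toH1 Ω (φ : H2 Ω), Submodule.mem_comap.1 φ.2⟩

theorem isSolution_controlToState {c : Coeffs n} (hc : c.IsAdmissible Ω)
    (hcoer : c.IsCoercive Ω) (f : L2 Ω) (φ : ControlSpace Ω) :
    IsSolution c f (ControlSpace.toH10 φ : H1 Ω) (controlToState c f φ) :=
  Classical.epsilon_spec (exists_isSolution hc hcoer f (ControlSpace.toH10 φ).2)

theorem isSolution_iff_eq_controlToState {c : Coeffs n} (hc : c.IsAdmissible Ω)
    (hcoer : c.IsCoercive Ω) (f : L2 Ω) (φ : ControlSpace Ω) (y : H10 Ω) :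
    IsSolution c f (ControlSpace.toH10 φ : H1 Ω) y ↔ y = controlToState c f φ :=
  ⟨fun hy => hy.unique hc hcoer (isSolution_controlToState hc hcoer f φ),
    fun hy => hy ▸ isSolution_controlToState hc hcoer f φ⟩

/-! ### Rellich's theorem for test functions, via the Fourier transform -/

open scoped SchwartzMap LineDeriv FourierTransform

/-- A test function as a complex-valued Schwartz function. -/
def IsTest.toSchwartz {φ : E n → ℝ} (h : IsTest Ω φ) : 𝓢(E n, ℂ) :=
  HasCompactSupport.toSchwartzMap (f := fun x => (φ x : ℂ))
    (h.compact.comp_left (g := Complex.ofReal) Complex.ofReal_zero)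
    (Complex.ofRealCLM.contDiff.comp h.smooth)

theorem IsTest.toSchwartz_apply {φ : E n → ℝ} (h : IsTest Ω φ) (x : E n) :
    h.toSchwartz x = φ x := rfl

theorem IsTest.lineDeriv_toSchwartz {φ : E n → ℝ} (h : IsTest Ω φ) (i : Fin n) (x : E n) :
    (∂_{EuclideanSpace.single i (1 : ℝ)} h.toSchwartz) x = (pderiv i φ x : ℂ) := by
  rw [SchwartzMap.lineDerivOp_apply_eq_fderiv]
  have h1 : HasFDerivAt φ (fderiv ℝ φ x) x :=
    (h.smooth.differentiable (by simp) x).hasFDerivAt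
  have h2 : HasFDerivAt h.toSchwartz (Complex.ofRealCLM ∘L fderiv ℝ φ x) x :=
    Complex.ofRealCLM.hasFDerivAt.comp x h1
  rw [h2.fderiv]
  rfl

theorem IsTest.eq_zero {φ : E n → ℝ} (h : IsTest Ω φ) {x : E n} (hx : x ∉ Ω) : φ x = 0 :=
  image_eq_zero_of_notMem_tsupport fun hx' => hx (h.subset hx')

theorem IsTest.integral_sq_fourier {φ : E n → ℝ} (h : IsTest Ω φ) :
    ∫ ξ, ‖𝓕 h.toSchwartz ξ‖ ^ 2 = ∫ x, φ x ^ 2 := by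
  rw [SchwartzMap.integral_norm_sq_fourier]
  simp [h.toSchwartz_apply]

theorem norm_fourier_lineDeriv_sq (f : 𝓢(E n, ℂ)) (i : Fin n) (ξ : E n) :
    ‖𝓕 (∂_{EuclideanSpace.single i (1 : ℝ)} f) ξ‖ ^ 2
      = (2 * Real.pi) ^ 2 * (ξ i ^ 2 * ‖𝓕 f ξ‖ ^ 2) := by
  have : (fun x : E n => inner ℝ x (EuclideanSpace.single i (1 : ℝ))).HasTemperateGrowth := by
    fun_prop
  rw [SchwartzMap.fourier_lineDerivOp_eq, smul_apply,
    SchwartzMap.smulLeftCLM_apply_apply this]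
  simp [EuclideanSpace.inner_single_right, mul_pow]

theorem integrable_norm_sq_schwartz (f : 𝓢(E n, ℂ)) : Integrable fun ξ => ‖f ξ‖ ^ 2 :=
  (memLp_two_iff_integrable_sq_norm f.continuous.aestronglyMeasurable).1 (f.memLp 2)

theorem IsTest.integrable_coord_sq_mul_fourier {φ : E n → ℝ} (h : IsTest Ω φ) (i : Fin n) :
    Integrable fun ξ : E n => ξ i ^ 2 * ‖𝓕 h.toSchwartz ξ‖ ^ 2 := by
  have := integrable_norm_sq_schwartz (𝓕 (∂_{EuclideanSpace.single i (1 : ℝ)} h.toSchwartz))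
  simp_rw [norm_fourier_lineDeriv_sq] at this
  exact (integrable_const_mul_iff (IsUnit.mk0 _ (by positivity)) _).1 this

theorem IsTest.integral_coord_sq_mul_fourier_le {φ : E n → ℝ} (h : IsTest Ω φ) (i : Fin n) :
    ∫ ξ : E n, ξ i ^ 2 * ‖𝓕 h.toSchwartz ξ‖ ^ 2 ≤ ∫ x, pderiv i φ x ^ 2 := by
  have h1 := SchwartzMap.integral_norm_sq_fourier
    (∂_{EuclideanSpace.single i (1 : ℝ)} h.toSchwartz)
  simp_rw [norm_fourier_lineDeriv_sq, h.lineDeriv_toSchwartz, integral_const_mul] at h1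
  have h2 : 0 ≤ ∫ ξ : E n, ξ i ^ 2 * ‖𝓕 h.toSchwartz ξ‖ ^ 2 :=
    integral_nonneg fun ξ => by positivity
  -- The Fourier normalization constant exceeds one and is simply dropped.
  have h3 : (1 : ℝ) ≤ (2 * Real.pi) ^ 2 := by nlinarith [Real.pi_gt_three]
  calc _ ≤ (2 * Real.pi) ^ 2 * ∫ ξ : E n, ξ i ^ 2 * ‖𝓕 h.toSchwartz ξ‖ ^ 2 :=
        le_mul_of_one_le_left h2 h3
    _ = _ := by rw [h1]; simp

/-- The high frequencies of a test function are controlled by its gradient. -/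
theorem IsTest.integral_sq_le {φ : E n → ℝ} (h : IsTest Ω φ) {R : ℝ} (hR : 0 < R) :
    ∫ x, φ x ^ 2 ≤ (∫ ξ in Metric.closedBall 0 R, ‖𝓕 h.toSchwartz ξ‖ ^ 2)
      + (∑ i, ∫ x, pderiv i φ x ^ 2) / R ^ 2 := by
  rw [← h.integral_sq_fourier, ← integral_add_compl (s := Metric.closedBall (0 : E n) R)
    measurableSet_closedBall (integrable_norm_sq_schwartz _)]
  gcongr
  rw [le_div_iff₀ (by positivity), ← integral_mul_const]
  have hint : Integrable fun ξ : E n => ∑ i, ξ i ^ 2 * ‖𝓕 h.toSchwartz ξ‖ ^ 2 :=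
    integrable_finsetSum _ fun i _ => h.integrable_coord_sq_mul_fourier i
  -- Off the ball, `R² ≤ ‖ξ‖² = ∑ ξᵢ²`, and the weights `ξᵢ²` turn into derivatives by Plancherel.
  calc ∫ ξ in (Metric.closedBall (0 : E n) R)ᶜ, ‖𝓕 h.toSchwartz ξ‖ ^ 2 * R ^ 2
      ≤ ∫ ξ in (Metric.closedBall (0 : E n) R)ᶜ, ∑ i, ξ i ^ 2 * ‖𝓕 h.toSchwartz ξ‖ ^ 2 := by
        refine setIntegral_mono_on ((integrable_norm_sq_schwartz _).mul_const _).integrableOn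
          hint.integrableOn measurableSet_closedBall.compl fun ξ hξ => ?_
        rw [← Finset.sum_mul, mul_comm]
        gcongr
        have : R < ‖ξ‖ := by simpa using hξ
        rw [← EuclideanSpace.real_norm_sq_eq]
        gcongr
    _ ≤ ∫ ξ : E n, ∑ i, ξ i ^ 2 * ‖𝓕 h.toSchwartz ξ‖ ^ 2 :=
        setIntegral_le_integral hint
          (Eventually.of_forall fun ξ => Finset.sum_nonneg fun i _ => by positivity)
    _ ≤ _ := by
        rw [integral_finsetSum _ fun i _ => h.integrable_coord_sq_mul_fourier i]
        exact Finset.sum_le_sum fun i _ => h.integral_coord_sq_mul_fourier_le i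

theorem IsTest.integrable {φ : E n → ℝ} (h : IsTest Ω φ) : Integrable φ :=
  h.smooth.continuous.integrable_of_hasCompactSupport h.compact

/-- Expresses each Fourier value through two real pairings over `Ω`, to which weak `L²` convergence
applies. -/
theorem IsTest.fourier_eq {φ : E n → ℝ} (h : IsTest Ω φ) (ξ : E n) :
    𝓕 h.toSchwartz ξ = ((∫ x in Ω, φ x * Real.cos (-2 * Real.pi * inner ℝ x ξ) : ℝ) : ℂ)
      + ((∫ x in Ω, φ x * Real.sin (-2 * Real.pi * inner ℝ x ξ) : ℝ) : ℂ) * Complex.I := by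
  have hz : ∀ g : E n → ℝ, ∫ x in Ω, φ x * g x = ∫ x, φ x * g x := fun g =>
    setIntegral_eq_integral_of_forall_compl_eq_zero fun x hx => by rw [h.eq_zero hx, zero_mul]
  have hi : ∀ g : E n → ℝ, Continuous g → Integrable fun x => φ x * g x := fun g hg =>
    (h.smooth.continuous.mul hg).integrable_of_hasCompactSupport h.compact.mul_right
  rw [hz, hz, SchwartzMap.fourier_coe, Real.fourier_eq', ← integral_complex_ofReal, ← integral_complex_ofReal,
    ← integral_mul_const, ← integral_add]
  · refine integral_congr_ae (Eventually.of_forall fun x => ?_)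
    simp only [h.toSchwartz_apply, Complex.exp_mul_I, smul_eq_mul]
    push_cast
    ring
  · exact (hi _ (by fun_prop)).ofReal
  · exact (hi _ (by fun_prop)).ofReal.mul_const _

/-- From `|φ| ≤ 1 + φ²` on `Ω`. The bound is uniform in `ξ`, so it dominates on balls. -/
theorem IsTest.norm_fourier_le {φ : E n → ℝ} (h : IsTest Ω φ) (hΩ : volume Ω ≠ ⊤)
    (ξ : E n) : ‖𝓕 h.toSchwartz ξ‖ ≤ volume.real Ω + ∫ x, φ x ^ 2 := by
  have hsq : Integrable fun x => φ x ^ 2 := by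
    simp_rw [pow_two]
    exact (h.smooth.continuous.mul h.smooth.continuous).integrable_of_hasCompactSupport
      h.compact.mul_right
  have : IsFiniteMeasure (volume.restrict Ω) := ⟨by simpa using hΩ.lt_top⟩
  calc ‖𝓕 h.toSchwartz ξ‖ ≤ ∫ x, ‖h.toSchwartz x‖ := by
        rw [SchwartzMap.fourier_coe, Real.fourier_eq']
        refine (norm_integral_le_integral_norm _).trans_eq ?_
        simp_rw [norm_smul, Complex.norm_exp_ofReal_mul_I, one_mul]
    _ = ∫ x in Ω, |φ x| := by
        rw [setIntegral_eq_integral_of_forall_compl_eq_zero fun x hx => by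
          rw [h.eq_zero hx, abs_zero]]
        simp [h.toSchwartz_apply]
    _ ≤ ∫ x in Ω, (1 + φ x ^ 2) := by
        refine integral_mono h.integrable.abs.integrableOn
          ((integrable_const _).add hsq.integrableOn) fun x => ?_
        change |φ x| ≤ 1 + φ x ^ 2
        nlinarith [sq_abs (φ x), sq_nonneg (|φ x| - 1)]
    _ = volume.real Ω + ∫ x, φ x ^ 2 := by
        rw [integral_add (integrable_const _) hsq.integrableOn,
          setIntegral_eq_integral_of_forall_compl_eq_zero (f := fun x => φ x ^ 2) fun x hx => by
            rw [h.eq_zero hx, zero_pow two_ne_zero]]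
        simp

/-- Rellich's theorem for test functions: boundedness in `H¹` and weak convergence to `0` in `L²`
imply strong convergence to `0` in `L²`. -/
theorem tendsto_integral_sq_of_isTest (hΩ : volume Ω ≠ ⊤) {φ : ℕ → E n → ℝ}
    (hφ : ∀ k, IsTest Ω (φ k)) {C : ℝ} (hC : ∀ k, ∫ x, φ k x ^ 2 ≤ C)
    (hC' : ∀ k i, ∫ x, pderiv i (φ k) x ^ 2 ≤ C)
    (hw : ∀ g : E n → ℝ, MemLp g 2 (volume.restrict Ω) →
      Tendsto (fun k => ∫ x in Ω, φ k x * g x) atTop (𝓝 0)) :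
    Tendsto (fun k => ∫ x, φ k x ^ 2) atTop (𝓝 0) := by
  have : IsFiniteMeasure (volume.restrict Ω) := ⟨by simpa using hΩ.lt_top⟩
  -- As `Ω` has finite measure, the bounded functions `cos` and `sin` are admissible `L²` test
  -- functions.
  have hpt : ∀ ξ, Tendsto (fun k => 𝓕 (hφ k).toSchwartz ξ) atTop (𝓝 0) := fun ξ => by
    have hc := hw (fun x => Real.cos (-2 * Real.pi * inner ℝ x ξ))
      (MemLp.of_bound (by fun_prop) 1 (Eventually.of_forall fun x => Real.abs_cos_le_one _))
    have hs := hw (fun x => Real.sin (-2 * Real.pi * inner ℝ x ξ))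
      (MemLp.of_bound (by fun_prop) 1 (Eventually.of_forall fun x => Real.abs_sin_le_one _))
    simp_rw [fun k => (hφ k).fourier_eq ξ]
    simpa using ((Complex.continuous_ofReal.tendsto 0).comp hc).add
      (((Complex.continuous_ofReal.tendsto 0).comp hs).mul_const Complex.I)
  have hlow : ∀ R : ℝ, Tendsto
      (fun k => ∫ ξ in Metric.closedBall (0 : E n) R, ‖𝓕 (hφ k).toSchwartz ξ‖ ^ 2)
      atTop (𝓝 0) := fun R => by
    have hfin : IsFiniteMeasure (volume.restrict (Metric.closedBall (0 : E n) R)) :=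
      ⟨by simpa using measure_closedBall_lt_top⟩
    have := tendsto_integral_of_dominated_convergence
      (μ := volume.restrict (Metric.closedBall (0 : E n) R))
      (F := fun k ξ => ‖𝓕 (hφ k).toSchwartz ξ‖ ^ 2) (f := fun _ => 0)
      (fun _ => (volume.real Ω + C) ^ 2)
      (fun k => ((𝓕 (hφ k).toSchwartz).continuous.norm.pow 2).aestronglyMeasurable)
      (integrable_const _)
      (fun k => Eventually.of_forall fun ξ => ?_)
      (Eventually.of_forall fun ξ => by simpa using (hpt ξ).norm.pow 2)
    · simpa using this
    · rw [norm_pow, norm_norm]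
      gcongr
      exact ((hφ k).norm_fourier_le hΩ ξ).trans (by gcongr; exact hC k)
  have hC0 : 0 ≤ C := (integral_nonneg fun x => sq_nonneg _).trans (hC 0)
  rw [Metric.tendsto_atTop]
  intro ε hε
  -- The tail bound is independent of `k`, so `R` can be fixed before `N`.
  obtain ⟨R, hR, hRε⟩ : ∃ R : ℝ, 0 < R ∧ n * C / R ^ 2 < ε / 2 := by
    have : Tendsto (fun R : ℝ => n * C / R ^ 2) atTop (𝓝 0) :=
      tendsto_const_nhds.div_atTop (tendsto_pow_atTop two_ne_zero)
    exact ((eventually_gt_atTop 0).and (this.eventually_lt_const (half_pos hε))).exists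
  obtain ⟨N, hN⟩ := eventually_atTop.1 ((hlow R).eventually_lt_const (half_pos hε))
  refine ⟨N, fun k hk => ?_⟩
  rw [Real.dist_0_eq_abs, abs_of_nonneg (integral_nonneg fun x => sq_nonneg _)]
  have h1 := (hφ k).integral_sq_le hR
  have h2 : (∑ i, ∫ x, pderiv i (φ k) x ^ 2) / R ^ 2 ≤ n * C / R ^ 2 := by
    gcongr
    simpa using Finset.sum_le_sum fun (i : Fin n) (_ : i ∈ Finset.univ) => hC' k i
  linarith [hN k hk]

/-! ### Rellich's theorem in `H¹₀(Ω)` -/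

theorem IsTest.pderiv {φ : E n → ℝ} (h : IsTest Ω φ) (i : Fin n) :
    IsTest Ω (Obstacle.pderiv i φ) where
  smooth := (h.smooth.fderiv_right (m := ∞) (by simp)).clm_apply contDiff_const
  compact := h.compact.fderiv_apply ℝ _
  subset := (tsupport_fderiv_apply_subset ℝ _).trans h.subset

theorem IsTest.setIntegral_mul_eq {φ : E n → ℝ} (h : IsTest Ω φ) (g : E n → ℝ) :
    ∫ x in Ω, φ x * g x = ∫ x, φ x * g x :=
  setIntegral_eq_integral_of_forall_compl_eq_zero fun x hx => by rw [h.eq_zero hx, zero_mul]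

theorem IsTest.integral_mul_pderiv {φ ψ : E n → ℝ} (hφ : IsTest Ω φ) (hψ : IsTest Ω ψ)
    (i : Fin n) :
    ∫ x in Ω, φ x * Obstacle.pderiv i ψ x = -∫ x in Ω, Obstacle.pderiv i φ x * ψ x := by
  have hi {φ ψ : E n → ℝ} (hφ : IsTest Ω φ) (hψ : IsTest Ω ψ) :
      Integrable fun x => φ x * ψ x :=
    (hφ.smooth.continuous.mul hψ.smooth.continuous).integrable_of_hasCompactSupport
      hφ.compact.mul_right
  rw [hφ.setIntegral_mul_eq, (hφ.pderiv i).setIntegral_mul_eq]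
  exact integral_mul_fderiv_eq_neg_fderiv_mul_of_integrable (hi (hφ.pderiv i) hψ)
    (hi hφ (hψ.pderiv i)) (hi hφ hψ)
    (fun x _ => hφ.smooth.differentiable (by simp) x)
    (fun x _ => hψ.smooth.differentiable (by simp) x)

/-- The weak derivative of a test function is its classical derivative. -/
theorem HasWeakDeriv.ae_eq_pderiv (hΩ : IsOpen Ω) {i : Fin n} {u g : L2 Ω}
    (h : HasWeakDeriv Ω i u g) {φ : E n → ℝ} (hφ : IsTest Ω φ)
    (hu : u =ᵐ[volume.restrict Ω] φ) : g =ᵐ[volume.restrict Ω] pderiv i φ := by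
  have hmem : MemLp (fun x => g x - pderiv i φ x) 2 (volume.restrict Ω) :=
    (Lp.memLp g).sub (hφ.memLp_pderiv i)
  -- Integration by parts makes `g - ∂ᵢφ` orthogonal to every test function; the fundamental lemma
  -- of the calculus of variations applies.
  have key := hΩ.ae_eq_zero_of_integral_contDiff_smul_eq_zero (μ := volume.restrict Ω)
    ((hmem.locallyIntegrable (by norm_num)).locallyIntegrableOn Ω) fun ψ h1 h2 h3 => by
      have hψ : IsTest Ω ψ := ⟨h1, h2, h3⟩
      have e1 : ∫ x in Ω, u x * pderiv i ψ x = ∫ x in Ω, φ x * pderiv i ψ x :=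
        integral_congr_ae (by filter_upwards [hu] with x hx; rw [hx])
      have e2 : ∫ x in Ω, g x * ψ x = ∫ x in Ω, pderiv i φ x * ψ x := by
        rw [← neg_inj, ← h ψ hψ, e1, hφ.integral_mul_pderiv hψ]
      have e3 : ∀ x, ψ x • (g x - pderiv i φ x) = g x * ψ x - pderiv i φ x * ψ x := fun x => by
        rw [smul_eq_mul]; ring
      simp_rw [e3]
      have hint : Integrable (fun x => pderiv i φ x * ψ x) (volume.restrict Ω) :=
        (hφ.memLp_pderiv i).integrable_mul hψ.memLp
      rw [integral_sub (L2.integrable_mul g hψ.memLp) hint, e2, sub_self]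
  filter_upwards [key, ae_restrict_mem hΩ.measurableSet] with x h1 h2
  exact sub_eq_zero.1 (h1 h2)

theorem L2.norm_sq_eq_integral {u : L2 Ω} {φ : E n → ℝ} (hφ : IsTest Ω φ)
    (hu : u =ᵐ[volume.restrict Ω] φ) : ‖u‖ ^ 2 = ∫ x, φ x ^ 2 := by
  simp_rw [pow_two (φ _)]
  rw [← real_inner_self_eq_norm_sq, MeasureTheory.L2.inner_def, ← hφ.setIntegral_mul_eq]
  refine integral_congr_ae ?_
  filter_upwards [hu] with x hx
  simp [hx, pow_two]

theorem exists_mem_testSubspace_norm_sub_lt (u : H10 Ω) {ε : ℝ} (hε : 0 < ε) :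
    ∃ t ∈ testSubspace Ω, ‖(u : H1 Ω) - t‖ < ε := by
  have hu : (u : H1 Ω) ∈ closure (testSubspace Ω : Set (H1 Ω)) := u.2
  simpa [dist_eq_norm] using Metric.mem_closure_iff.1 hu ε hε

theorem tendsto_norm_fn_of_testSubspace (hΩ : IsOpen Ω) (hfin : volume Ω ≠ ⊤) {t : ℕ → H1 Ω}
    (ht : ∀ k, t k ∈ testSubspace Ω) (h : WeaklyConverges t 0) :
    Tendsto (fun k => ‖H1.fn (t k)‖) atTop (𝓝 0) := by
  choose φ hφ hae using ht
  obtain ⟨C, hC⟩ := h.exists_norm_le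
  have hsq : Tendsto (fun k => ∫ x, φ k x ^ 2) atTop (𝓝 0) := by
    refine tendsto_integral_sq_of_isTest hfin hφ (C := C ^ 2) (fun k => ?_) (fun k i => ?_)
      fun g hg => ?_
    · rw [← L2.norm_sq_eq_integral (hφ k) (hae k)]
      exact pow_le_pow_left₀ (norm_nonneg _) ((H1.norm_fn_le _).trans (hC k)) 2
    · rw [← L2.norm_sq_eq_integral ((hφ k).pderiv i)
        (((t k).2 i).ae_eq_pderiv hΩ (hφ k) (hae k))]
      exact pow_le_pow_left₀ (norm_nonneg _) ((H1.norm_deriv_le (t k) i).trans (hC k)) 2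
    · have h1 := h ((innerSL ℝ (hg.toLp g)) ∘L H1.fnL Ω)
      rw [map_zero] at h1
      refine h1.congr fun k => ?_
      change inner ℝ (hg.toLp g) (H1.fn (t k)) = _
      rw [L2.inner_toLp]
      exact integral_congr_ae (by filter_upwards [hae k] with x hx; rw [hx])
  have h2 : Tendsto (fun k => ‖H1.fn (t k)‖ ^ 2) atTop (𝓝 0) :=
    hsq.congr fun k => (L2.norm_sq_eq_integral (hφ k) (hae k)).symm
  simpa using h2.sqrt

/-- Rellich's theorem: the inclusion `H¹₀(Ω) ⊆ L²(Ω)` maps weakly convergent sequences to strongly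
convergent ones. -/
theorem tendsto_norm_fn_of_weaklyConverges (hΩ : IsOpen Ω) (hfin : volume Ω ≠ ⊤) {d : ℕ → H10 Ω}
    (h : WeaklyConverges (fun k => (d k : H1 Ω)) 0) :
    Tendsto (fun k => ‖H1.fn (d k : H1 Ω)‖) atTop (𝓝 0) := by
  -- Approximating within `1 / (k + 1)` keeps the sequence weakly null and changes `L²` norms by a
  -- null sequence.
  choose t ht htd using fun k : ℕ =>
    exists_mem_testSubspace_norm_sub_lt (d k) (Nat.one_div_pos_of_nat (α := ℝ) (n := k))
  have h0 : Tendsto (fun k => ‖(d k : H1 Ω) - t k‖) atTop (𝓝 0) :=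
    squeeze_zero (fun k => norm_nonneg _) (fun k => (htd k).le)
      tendsto_one_div_add_atTop_nhds_zero_nat
  have hw : WeaklyConverges t 0 := fun ℓ => by
    have h1 := (h ℓ).sub ((ℓ.continuous.tendsto 0).comp (tendsto_zero_iff_norm_tendsto_zero.2 h0))
    simpa [Function.comp_def] using h1
  refine squeeze_zero (fun k => norm_nonneg _) (fun k => ?_)
    (by simpa using h0.add (tendsto_norm_fn_of_testSubspace hΩ hfin ht hw))
  calc ‖H1.fn (d k : H1 Ω)‖ = ‖H1.fn ((d k : H1 Ω) - t k) + H1.fn (t k)‖ := by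
        rw [← H1.fnL_apply ((d k : H1 Ω) - t k), map_sub, H1.fnL_apply, H1.fnL_apply,
          sub_add_cancel]
    _ ≤ ‖H1.fn ((d k : H1 Ω) - t k)‖ + ‖H1.fn (t k)‖ := norm_add_le _ _
    _ ≤ _ := by gcongr; exact H1.norm_fn_le _

/-! ### From weak `H²` to strong `H¹` convergence -/

/-- The inclusion `H²(Ω) ⊆ H¹(Ω)` as a continuous linear map. -/
def H2.toH1L (Ω : Set (E n)) : H2 Ω →L[ℝ] H1 Ω :=
  ((WithLp.fstL 2 ℝ (Jet1 Ω) (PiLp 2 fun _ : Fin n × Fin n => L2 Ω)) ∘L (H2 Ω).subtypeL).codRestrict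
    (H1 Ω) fun w => w.2.1

/-- The Laplacian as a continuous linear map `H²(Ω) → L²(Ω)`. -/
def H2.laplacianL (Ω : Set (E n)) : H2 Ω →L[ℝ] L2 Ω :=
  ∑ i : Fin n, (PiLp.proj 2 (fun _ : Fin n × Fin n => L2 Ω) (i, i)) ∘L
    (WithLp.sndL 2 ℝ (Jet1 Ω) (PiLp 2 fun _ : Fin n × Fin n => L2 Ω)) ∘L (H2 Ω).subtypeL

theorem H2.laplacianL_apply (w : H2 Ω) :
    H2.laplacianL Ω w = ∑ i : Fin n, (w : Jet2 Ω).snd (i, i) := by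
  rw [H2.laplacianL, sum_apply]
  rfl

/-- Green's formula `∫ ∇w ⬝ ∇v = -∫ Δw v` for `w ∈ H²(Ω)` and `v ∈ H¹₀(Ω)`. -/
theorem sum_inner_deriv_eq (hΩ : IsOpen Ω) (w : H2 Ω) (v : H10 Ω) :
    ∑ i, inner ℝ (H1.deriv (H2.toH1 Ω w) i) (H1.deriv (v : H1 Ω) i)
      = -inner ℝ (H2.laplacianL Ω w) (H1.fn (v : H1 Ω)) := by
  have hcl : IsClosed {v : H1 Ω | ∑ i, inner ℝ (H1.deriv (H2.toH1 Ω w) i) (H1.derivL Ω i v)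
      = -inner ℝ (H2.laplacianL Ω w) (H1.fnL Ω v)} :=
    isClosed_eq (by fun_prop) (by fun_prop)
  -- Both sides are continuous in `v`, so test functions suffice; there the formula is the
  -- definition of the weak derivatives `∂ᵢ∂ᵢw`.
  refine closure_minimal (s := (testSubspace Ω : Set (H1 Ω))) ?_ hcl v.2
  rintro u ⟨φ, hφ, hu⟩
  have e {a b : L2 Ω} {ψ : E n → ℝ} (hb : b =ᵐ[volume.restrict Ω] ψ) :
      inner ℝ a b = ∫ x in Ω, a x * ψ x := by
    rw [MeasureTheory.L2.inner_def]
    refine integral_congr_ae ?_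
    filter_upwards [hb] with x hx
    simp [hx, mul_comm]
  change ∑ i, inner ℝ (H1.deriv (H2.toH1 Ω w) i) (H1.deriv u i)
    = -inner ℝ (H2.laplacianL Ω w) (H1.fn u)
  rw [H2.laplacianL_apply, sum_inner, ← Finset.sum_neg_distrib]
  refine Finset.sum_congr rfl fun i _ => ?_
  have hd : H1.deriv u i =ᵐ[volume.restrict Ω] pderiv i φ := (u.2 i).ae_eq_pderiv hΩ hφ hu
  rw [e hu, e hd]
  exact w.2.2 i i φ hφ

/-- Green's formula tested with the function itself: the gradient is controlled by the Laplacian and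
the `L²` norm. -/
theorem norm_sq_le_of_mem_controlSpace (hΩ : IsOpen Ω) (w : H2 Ω) (v : H10 Ω)
    (h : H2.toH1 Ω w = v) :
    ‖(v : H1 Ω)‖ ^ 2 ≤ ‖H1.fn (v : H1 Ω)‖ ^ 2
      + ‖H2.laplacianL Ω w‖ * ‖H1.fn (v : H1 Ω)‖ := by
  have h1 := sum_inner_deriv_eq hΩ w v
  rw [h] at h1
  simp_rw [real_inner_self_eq_norm_sq] at h1
  rw [H1.norm_sq_eq, h1]
  gcongr
  exact (neg_le_abs _).trans (abs_real_inner_le_norm _ _)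

theorem ControlSpace.coe_toH10_sub (φ φ' : ControlSpace Ω) :
    ((ControlSpace.toH10 φ - ControlSpace.toH10 φ' : H10 Ω) : H1 Ω)
      = H2.toH1L Ω φ - H2.toH1L Ω φ' := rfl

theorem ControlSpace.norm_toH10_sub_sq_le (hΩ : IsOpen Ω) (φ φ' : ControlSpace Ω) {C : ℝ}
    (hC : ‖(φ : H2 Ω)‖ ≤ C) :
    ‖ControlSpace.toH10 φ - ControlSpace.toH10 φ'‖ ^ 2
      ≤ ‖H1.fn ((ControlSpace.toH10 φ - ControlSpace.toH10 φ' : H10 Ω) : H1 Ω)‖ ^ 2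
        + ‖H2.laplacianL Ω‖ * (C + ‖(φ' : H2 Ω)‖)
          * ‖H1.fn ((ControlSpace.toH10 φ - ControlSpace.toH10 φ' : H10 Ω) : H1 Ω)‖ := by
  have h := norm_sq_le_of_mem_controlSpace hΩ ((φ : H2 Ω) - φ')
    (ControlSpace.toH10 φ - ControlSpace.toH10 φ')
    (by rw [ControlSpace.coe_toH10_sub]; exact map_sub (H2.toH1L Ω) _ _)
  have h2 : ‖H2.laplacianL Ω ((φ : H2 Ω) - φ')‖ ≤ ‖H2.laplacianL Ω‖ * (C + ‖(φ' : H2 Ω)‖) :=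
    (ContinuousLinearMap.le_opNorm _ _).trans (mul_le_mul_of_nonneg_left
      ((norm_sub_le _ _).trans (add_le_add_left hC _)) (norm_nonneg _))
  exact h.trans (add_le_add_right (mul_le_mul_of_nonneg_right h2 (norm_nonneg _)) _)

/-- On the control space, weak convergence in `H²(Ω)` implies strong convergence in `H¹₀(Ω)`. -/
theorem tendsto_norm_toH10_sub (hΩ : IsOpen Ω) (hfin : volume Ω ≠ ⊤) {φ : ℕ → ControlSpace Ω}
    {φ' : ControlSpace Ω} (h : WeaklyConverges (fun k => (φ k : H2 Ω)) (φ' : H2 Ω)) :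
    Tendsto (fun k => ‖ControlSpace.toH10 (φ k) - ControlSpace.toH10 φ'‖) atTop (𝓝 0) := by
  have hw : WeaklyConverges
      (fun k => ((ControlSpace.toH10 (φ k) - ControlSpace.toH10 φ' : H10 Ω) : H1 Ω)) 0 := by
    simp_rw [ControlSpace.coe_toH10_sub]
    exact (h.map (H2.toH1L Ω)).sub_limit
  have hfn := tendsto_norm_fn_of_weaklyConverges hΩ hfin hw
  obtain ⟨C, hC⟩ := h.exists_norm_le
  have hsq := squeeze_zero (fun k => sq_nonneg _)
    (fun k => ControlSpace.norm_toH10_sub_sq_le hΩ (φ k) φ' (hC k))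
    (by simpa using (hfn.pow 2).add (hfn.const_mul (‖H2.laplacianL Ω‖ * (C + ‖(φ' : H2 Ω)‖))))
  simpa using hsq.sqrt

theorem tendsto_controlToState (hΩ : IsOpen Ω) (hfin : volume Ω ≠ ⊤) {c : Coeffs n}
    (hc : c.IsAdmissible Ω) (hcoer : c.IsCoercive Ω) (f : L2 Ω) {φ : ℕ → ControlSpace Ω}
    {φ' : ControlSpace Ω} (h : WeaklyConverges (fun k => (φ k : H2 Ω)) (φ' : H2 Ω)) :
    Tendsto (fun k => controlToState c f (φ k)) atTop (𝓝 (controlToState c f φ')) := by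
  obtain ⟨C, hC⟩ := exists_norm_sub_le hc hcoer f
  rw [tendsto_iff_norm_sub_tendsto_zero]
  refine squeeze_zero (fun k => norm_nonneg _) (fun k => hC _ _ _ _
    (isSolution_controlToState hc hcoer f (φ k)) (isSolution_controlToState hc hcoer f φ')) ?_
  simpa using (tendsto_norm_toH10_sub hΩ hfin h).const_mul C

end Obstacle

end
theorem mainTheorem5 (n : ℕ) (hn : n ≤ 3) (Ω : Set (Obstacle.E n)) (hΩ : IsOpen Ω)
    (hb : Bornology.IsBounded Ω) (hL : Obstacle.HasLipschitzBoundary Ω)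
    (c : Obstacle.Coeffs n) (hc : c.IsAdmissible Ω) (hcoer : c.IsCoercive Ω)
    (f : Obstacle.L2 Ω) :
    (∀ φ : Obstacle.ControlSpace Ω, ∀ y : Obstacle.H10 Ω,
      Obstacle.IsSolution c f (Obstacle.H2.toH1 Ω (φ : Obstacle.H2 Ω)) y ↔
        y = Obstacle.controlToState c f φ) ∧
    ∀ (φ : ℕ → Obstacle.ControlSpace Ω) (φ' : Obstacle.ControlSpace Ω),
      Obstacle.WeaklyConverges (fun k => (φ k : Obstacle.H2 Ω)) (φ' : Obstacle.H2 Ω) →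
      Obstacle.WeaklyConverges (fun k => Obstacle.controlToState c f (φ k))
        (Obstacle.controlToState c f φ') :=
  ⟨Obstacle.isSolution_iff_eq_controlToState hc hcoer f, fun _ _ h =>
    Obstacle.WeaklyConverges.of_tendsto
      (Obstacle.tendsto_controlToState hΩ hb.measure_lt_top.ne hc hcoer f h)⟩
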